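/- Let $F$ be an algebraically closed field of characteristic $0$, let $n\ge 2$ and $R_n=F[x_1,\dots,x_n]$ with its standard grading. For $n\ge 3$ let \[ I_n=\Big\langle \prod_{j\ne i}x_j-x_i \;:\; 1\le i\le n\Big\rangle\lhd R_n, \] and let $I_2=\langle x_1,x_2\rangle\lhd R_2$. Let $K_n\lhd R_n$ be the ideal generated by the highest-degree homogeneous parts of all elements of $I_n$. Then $K_n$ is a homogeneous ideal of codimension (height) $n$, and the graded $F$-algebra $R_n/K_n$ is Artinian and Gorenstein (a Noetherian ring is Gorenstein if each of its localizations at prime ideals has finite injective dimension as a module over itself). Moreover its Hilbert series $h_n(t)=\sum_{k\ge 0}t^k\dim_F(R_n/K_n)_k$ is palindromic: $\dim_F(R_n/K_n)_k=\dim_F(R_n/K_n)_{2n-4-k}$ for $0\le k\le 2n-4$, and $(R_n/K_n)_k=0$ for $k>2n-4$. -/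

import Mathlib

open MvPolynomial

attribute [local instance] MvPolynomial.gradedAlgebra

noncomputable section

/-- A Gorenstein local ring: a Noetherian local ring of finite injective dimension as a module
over itself. -/
structure IsGorensteinLocalRing (A : Type*) [CommRing A] : Prop where
  isLocalRing : IsLocalRing A
  isNoetherianRing : IsNoetherianRing A
  injectiveDimension_ne_top :
    CategoryTheory.injectiveDimension (ModuleCat.of A A) ≠ ⊤

/-- A Gorenstein ring: a Noetherian ring all of whose localizations at prime ideals are
Gorenstein local rings. -/
structure IsGorensteinRing (A : Type*) [CommRing A] : Prop where
  isNoetherianRing : IsNoetherianRing A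
  localization (p : Ideal A) [p.IsPrime] : IsGorensteinLocalRing (Localization.AtPrime p)

/-- The ideal `I_n` of `F[x_1, …, x_n]` generated by the binomials `∏_{j ≠ i} x_j - x_i` for
`i = 1, …, n`, with the convention `I_2 = (x_1, x_2)` in the degenerate case `n = 2`. -/
def binomialIdeal (F : Type*) [Field F] (n : ℕ) : Ideal (MvPolynomial (Fin n) F) :=
  if n = 2 then Ideal.span (Set.range fun i : Fin n => X i)
  else Ideal.span (Set.range fun i : Fin n => (∏ j ∈ Finset.univ.erase i, X j) - X i)

/-- The ideal generated by the top-degree homogeneous parts of all elements of `I`. -/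
def topDegreeIdeal {F : Type*} [Field F] {n : ℕ} (I : Ideal (MvPolynomial (Fin n) F)) :
    Ideal (MvPolynomial (Fin n) F) :=
  Ideal.span ((fun f => homogeneousComponent f.totalDegree f) '' (I : Set (MvPolynomial (Fin n) F)))

/-- The degree `k` piece of the quotient of `F[x_1, …, x_n]` by `K` (a grading of the quotient
when `K` is homogeneous): the classes of the homogeneous polynomials of degree `k`. -/
def quotientPiece {F : Type*} [Field F] {n : ℕ} (K : Ideal (MvPolynomial (Fin n) F)) (k : ℕ) :
    Submodule F (MvPolynomial (Fin n) F ⧸ K) :=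
  (homogeneousSubmodule (Fin n) F k).map (Ideal.Quotient.mkₐ F K).toLinearMap

/-- The Hilbert series `∑ t ^ k dim_F (F[x_1, …, x_n] / K)_k`. -/
def hilbertSeries {F : Type*} [Field F] {n : ℕ} (K : Ideal (MvPolynomial (Fin n) F)) :
    PowerSeries ℕ :=
  PowerSeries.mk fun k => Module.finrank F (quotientPiece K k)

end

/-! The proof is Macaulay duality: `K_n` is the annihilator of the single functional with weight
`evenWeight F n (2 * n - 4)`. For `n ≥ 3` the nonzero solutions of `∏_{j ≠ i} x_j = x_i` form a
finite group. The average over it minus the value at the origin kills `I_n`, and on monomials it is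
the indicator of the nonzero exponents whose character is trivial. Up to degree `2n - 4` these are
the even exponents of degree exactly `2n - 4`, so the even functional kills all multiples of
top-degree parts (`topDegreeIdeal_binomialIdeal_le`). Only the resulting congruences on exponents
are used. Conversely, `K_n` contains all `x_i ^ 2 - x_j ^ 2` and all products of `n - 1` variables,
so the monomials `u ^ k ∏_{i ∈ S} x_i` with `u = x_1 ^ 2` and `k + |S| ≤ n - 2` span the quotient.
Pairing `(k, S)` with `(n - 2 - k - |S|, S)` shows that they are independent modulo the annihilator,
whence equality (`topDegreeIdeal_binomialIdeal_eq`). The induced nondegenerate form makes the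
quotient self-injective and puts degrees `k` and `2n - 4 - k` in duality. The variables are
nilpotent in the quotient, which gives the height and makes localization at a prime trivial. -/

/-- The linear functional on polynomials with prescribed values on the monomials. -/
noncomputable def weightFunctional {σ F : Type*} [Field F] (w : (σ →₀ ℕ) → F) :
    MvPolynomial σ F →ₗ[F] F :=
  (basisMonomials σ F).constr F w

/-! ### Functionals given by monomial weights, and their annihilators -/

section weightFunctional

variable {σ F : Type*} [Field F] (w : (σ →₀ ℕ) → F)

lemma weightFunctional_monomial (a : σ →₀ ℕ) (c : F) :
    weightFunctional w (monomial a c) = c * w a := by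
  have h := (basisMonomials σ F).constr_basis F w a
  rw [coe_basisMonomials] at h
  rw [weightFunctional, ← mul_one c, ← smul_eq_mul, ← smul_monomial, map_smul, h]
  simp

lemma weightFunctional_apply (f : MvPolynomial σ F) :
    weightFunctional w f = ∑ a ∈ f.support, f.coeff a * w a := by
  conv_lhs => rw [f.as_sum, map_sum]
  simp only [weightFunctional_monomial]

lemma weightFunctional_congr {w w' : (σ →₀ ℕ) → F} {f : MvPolynomial σ F}
    (h : ∀ a ∈ f.support, w a = w' a) : weightFunctional w f = weightFunctional w' f := by
  simp only [weightFunctional_apply]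
  exact Finset.sum_congr rfl fun a ha => by rw [h a ha]

lemma weightFunctional_eq_zero {w : (σ →₀ ℕ) → F} {f : MvPolynomial σ F}
    (h : ∀ a ∈ f.support, w a = 0) : weightFunctional w f = 0 := by
  rw [weightFunctional_apply]
  exact Finset.sum_eq_zero fun a ha => by rw [h a ha, mul_zero]

lemma weightFunctional_monomial_mul (b : σ →₀ ℕ) (c : F) (f : MvPolynomial σ F) :
    weightFunctional w (monomial b c * f) = c * weightFunctional (fun a => w (b + a)) f := by
  induction f using MvPolynomial.induction_on' with
  | monomial a d => simp only [monomial_mul, weightFunctional_monomial]; ring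
  | add p q hp hq => rw [mul_add, map_add, hp, hq, map_add, mul_add]

lemma weightFunctional_homogeneousComponent (d : ℕ) (f : MvPolynomial σ F) :
    weightFunctional w (homogeneousComponent d f) =
      weightFunctional (fun a => if a.degree = d then w a else 0) f := by
  rw [weightFunctional_apply, weightFunctional_apply, support_homogeneousComponent,
    Finset.sum_filter]
  refine Finset.sum_congr rfl fun a _ => ?_
  rw [coeff_homogeneousComponent]
  split_ifs <;> simp

/-- The ideal of those `f` such that the functional `μ` vanishes on all multiples of `f`. -/
def annihilatorIdeal {A : Type*} [CommRing A] [Algebra F A] (μ : A →ₗ[F] F) : Ideal A where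
  carrier := {f | ∀ g, μ (g * f) = 0}
  zero_mem' g := by simp
  add_mem' hf hg h := by rw [mul_add, map_add, hf, hg, add_zero]
  smul_mem' c f hf g := by rw [smul_eq_mul, ← mul_assoc]; exact hf _

lemma mem_annihilatorIdeal_weightFunctional {w : (σ →₀ ℕ) → F} {f : MvPolynomial σ F} :
    f ∈ annihilatorIdeal (weightFunctional w) ↔
      ∀ b, weightFunctional (fun a => w (b + a)) f = 0 := by
  refine ⟨fun h b => ?_, fun h g => ?_⟩
  · simpa [weightFunctional_monomial_mul] using h (monomial b 1)
  · induction g using MvPolynomial.induction_on' with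
    | monomial b c => rw [weightFunctional_monomial_mul, h, mul_zero]
    | add p q hp hq => rw [add_mul, map_add, hp, hq, add_zero]

end weightFunctional

/-! ### Top-degree ideals and functionals -/

section topDegree

variable {F : Type*} [Field F] {n : ℕ}

/-- The weight that is `1` on the monomials of degree `D` all of whose exponents are even, and `0`
on the other monomials. -/
noncomputable def evenWeight (F : Type*) [Field F] (n D : ℕ) (a : Fin n →₀ ℕ) : F :=
  open Classical in if a.degree = D ∧ ∀ i, Even (a i) then 1 else 0

/-- If a functional vanishes on `I` and agrees with `evenWeight` up to degree `D`, then the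
top-degree ideal of `I` is contained in the ideal determined by `evenWeight`. -/
lemma topDegreeIdeal_le_annihilatorIdeal {I : Ideal (MvPolynomial (Fin n) F)} {D : ℕ}
    (w : (Fin n →₀ ℕ) → F) (hI : I ≤ annihilatorIdeal (weightFunctional w))
    (hw : ∀ a : Fin n →₀ ℕ, a.degree ≤ D → w a = evenWeight F n D a) :
    topDegreeIdeal I ≤ annihilatorIdeal (weightFunctional (evenWeight F n D)) := by
  rw [topDegreeIdeal, Ideal.span_le]
  rintro _ ⟨f, hf, rfl⟩
  change homogeneousComponent _ f ∈ annihilatorIdeal _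
  rw [mem_annihilatorIdeal_weightFunctional]
  intro b
  rw [weightFunctional_homogeneousComponent]
  by_cases hb : b.degree + f.totalDegree = D
  -- All terms of `x ^ b * f` have degree at most `D`, where `w` is the even weight, and that weight
  -- sees only degree `D`, that is, the top part of `f`.
  · refine (weightFunctional_congr fun a ha => ?_).trans
      (mem_annihilatorIdeal_weightFunctional.mp (hI hf) b)
    have had : a.degree ≤ f.totalDegree := le_totalDegree ha
    have hba : (b + a).degree = b.degree + a.degree := map_add _ _ _
    rw [hw _ (by omega)]
    split_ifs with h
    · rfl
    · rw [evenWeight, if_neg]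
      rintro ⟨h', -⟩
      omega
  · refine weightFunctional_eq_zero fun a _ => ?_
    split_ifs with h
    · rw [evenWeight, if_neg]
      rintro ⟨h', -⟩
      have hba : (b + a).degree = b.degree + a.degree := map_add _ _ _
      omega
    · rfl

lemma homogeneousComponent_mem_topDegreeIdeal {I : Ideal (MvPolynomial (Fin n) F)}
    {f : MvPolynomial (Fin n) F} (hf : f ∈ I) {d : ℕ} (hd : f.totalDegree ≤ d) :
    homogeneousComponent d f ∈ topDegreeIdeal I := by
  obtain h | h := hd.lt_or_eq
  · rw [homogeneousComponent_eq_zero _ _ h]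
    exact zero_mem _
  · subst h
    exact Ideal.subset_span ⟨f, hf, rfl⟩

lemma isHomogeneous_topDegreeIdeal (I : Ideal (MvPolynomial (Fin n) F)) :
    (topDegreeIdeal I).IsHomogeneous (homogeneousSubmodule (Fin n) F) := by
  apply Ideal.homogeneous_span
  rintro _ ⟨f, -, rfl⟩
  exact ⟨_, homogeneousComponent_mem _ _⟩

end topDegree

/-! ### Elements of the top-degree ideal, and a functional killing `I_n` -/

section binomialIdeal

variable {F : Type*} [Field F] {n : ℕ}

lemma prod_erase_X_eq_monomial (i : Fin n) :
    ∏ j ∈ Finset.univ.erase i, (X j : MvPolynomial (Fin n) F) =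
      monomial (∑ j ∈ Finset.univ.erase i, Finsupp.single j 1) 1 := by
  rw [monomial_sum_one]
  rfl

lemma isHomogeneous_prod_erase_X (i : Fin n) :
    (∏ j ∈ Finset.univ.erase i, (X j : MvPolynomial (Fin n) F)).IsHomogeneous (n - 1) := by
  have h := IsHomogeneous.prod (Finset.univ.erase i) (fun j => (X j : MvPolynomial (Fin n) F))
    (fun _ => 1) (fun j _ => isHomogeneous_X F j)
  simpa using h

lemma prod_erase_mem_topDegreeIdeal (hn : 2 ≤ n) (i : Fin n) :
    ∏ j ∈ Finset.univ.erase i, (X j : MvPolynomial (Fin n) F) ∈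
      topDegreeIdeal (binomialIdeal F n) := by
  obtain rfl | hn := hn.eq_or_lt
  · obtain ⟨j, hj⟩ : ∃ j, j ∈ Finset.univ.erase i := by
      rw [← Finset.Nonempty, ← Finset.card_pos]; simp
    refine Ideal.mem_of_dvd _ (Finset.dvd_prod_of_mem _ hj) ?_
    have hX : (X j : MvPolynomial (Fin 2) F) ∈ binomialIdeal F 2 := by
      rw [binomialIdeal, if_pos rfl]
      exact Ideal.subset_span ⟨j, rfl⟩
    have h := homogeneousComponent_mem_topDegreeIdeal hX (d := 1) (by simp)
    rwa [homogeneousComponent_eq_self (isHomogeneous_X F j)] at h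
  · have hg : (∏ j ∈ Finset.univ.erase i, (X j : MvPolynomial (Fin n) F)) - X i ∈
        binomialIdeal F n := by
      rw [binomialIdeal, if_neg hn.ne']
      exact Ideal.subset_span ⟨i, rfl⟩
    have h := homogeneousComponent_mem_topDegreeIdeal hg (d := n - 1) (by
      refine (totalDegree_sub _ _).trans (max_le (isHomogeneous_prod_erase_X i).totalDegree_le ?_)
      simp; omega)
    rwa [map_sub, homogeneousComponent_eq_self (isHomogeneous_prod_erase_X i),
      homogeneousComponent_of_mem ((mem_homogeneousSubmodule _ _).mpr (isHomogeneous_X F i)),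
      if_neg (by omega), sub_zero] at h

/-- For `n ≠ 2`, each `x_i ^ 2` is congruent to the product of all variables modulo `I_n`. -/
lemma X_sq_sub_X_sq_mem_topDegreeIdeal (i j : Fin n) :
    (X i ^ 2 - X j ^ 2 : MvPolynomial (Fin n) F) ∈ topDegreeIdeal (binomialIdeal F n) := by
  have hmem : (X i ^ 2 - X j ^ 2 : MvPolynomial (Fin n) F) ∈ binomialIdeal F n := by
    rw [binomialIdeal]
    split_ifs with h
    · have hX (k : Fin n) : (X k : MvPolynomial (Fin n) F) ∈ Ideal.span (Set.range fun i => X i) :=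
        Ideal.subset_span ⟨k, rfl⟩
      exact sub_mem (Ideal.pow_mem_of_mem _ (hX i) 2 two_pos)
        (Ideal.pow_mem_of_mem _ (hX j) 2 two_pos)
    · have key : (X i ^ 2 - X j ^ 2 : MvPolynomial (Fin n) F) =
          X j * ((∏ k ∈ Finset.univ.erase j, X k) - X j) -
            X i * ((∏ k ∈ Finset.univ.erase i, X k) - X i) := by
        rw [mul_sub, mul_sub, Finset.mul_prod_erase _ _ (Finset.mem_univ i),
          Finset.mul_prod_erase _ _ (Finset.mem_univ j)]
        ring
      rw [key]
      exact sub_mem (Ideal.mul_mem_left _ _ (Ideal.subset_span ⟨j, rfl⟩))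
        (Ideal.mul_mem_left _ _ (Ideal.subset_span ⟨i, rfl⟩))
  have hhom : (X i ^ 2 - X j ^ 2 : MvPolynomial (Fin n) F).IsHomogeneous 2 :=
    (isHomogeneous_X_pow i 2).sub (isHomogeneous_X_pow j 2)
  have h := homogeneousComponent_mem_topDegreeIdeal hmem hhom.totalDegree_le
  rwa [homogeneousComponent_eq_self hhom] at h

/-- The exponents `a ≠ 0` of the monomials that are trivial on the group of nonzero solutions of
`∏_{j ≠ i} x_j = x_i`. -/
def IsTrivialExponent (a : Fin n →₀ ℕ) : Prop :=
  a ≠ 0 ∧ ∀ i, (a.degree : ℤ) ≡ a i * (n - 2) [ZMOD 2 * (n - 2)]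

lemma isTrivialExponent_iff_of_degree_le (hn : 3 ≤ n) {a : Fin n →₀ ℕ}
    (ha : a.degree ≤ 2 * n - 4) :
    IsTrivialExponent a ↔ a.degree = 2 * n - 4 ∧ ∀ i, Even (a i) := by
  have hmod (i : Fin n) : (Even (a i) → (a i * (n - 2) : ℤ) ≡ 0 [ZMOD 2 * (n - 2)]) ∧
      (¬ Even (a i) → (a i * (n - 2) : ℤ) ≡ n - 2 [ZMOD 2 * (n - 2)]) := by
    constructor
    · rintro ⟨r, hr⟩
      refine (Int.modEq_iff_dvd.mpr ⟨r, ?_⟩).symm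
      rw [hr]; push_cast; ring
    · intro h
      obtain ⟨r, hr⟩ := Nat.not_even_iff_odd.mp h
      refine (Int.modEq_iff_dvd.mpr ⟨r, ?_⟩).symm
      rw [hr]; push_cast; ring
  have hm : (0 : ℤ) < n - 2 := by omega
  constructor
  · rintro ⟨ha0, h⟩
    have hev : ∀ i, Even (a i) := by
      by_contra hcon
      push Not at hcon
      obtain ⟨i, hi⟩ := hcon
      have h1 : (a.degree : ℤ) ≡ n - 2 [ZMOD 2 * (n - 2)] :=
        (h i).trans ((hmod i).2 (by simpa using hi))
      -- An odd exponent forces degree `≡ n - 2`, a zero exponent forces degree `≡ 0`. Hence no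
      -- exponent vanishes and the degree is at least `n`; the next value `≡ n - 2` is `3(n - 2)`,
      -- beyond the bound.
      have hpos : ∀ j, 1 ≤ a j := by
        intro j
        by_contra hj
        have h2 : (a.degree : ℤ) ≡ 0 [ZMOD 2 * (n - 2)] :=
          (h j).trans ((hmod j).1 (by simp [show a j = 0 by omega]))
        have h3 := Int.modEq_iff_dvd.mp (h2.symm.trans h1)
        have := Int.le_of_dvd (by linarith) h3
        linarith
      have hdeg : n ≤ a.degree := by
        rw [Finsupp.degree_eq_sum]
        calc n = ∑ _j : Fin n, 1 := by simp
          _ ≤ _ := Finset.sum_le_sum fun j _ => hpos j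
      have h3 := Int.modEq_iff_dvd.mp h1.symm
      have := Int.le_of_dvd (by omega) h3
      omega
    refine ⟨?_, hev⟩
    have h2 : (a.degree : ℤ) ≡ 0 [ZMOD 2 * (n - 2)] :=
      (h ⟨0, by omega⟩).trans ((hmod _).1 (hev _))
    have hne : a.degree ≠ 0 := by rwa [ne_eq, Finsupp.degree_eq_zero_iff]
    have := Int.le_of_dvd (by omega) (Int.modEq_zero_iff_dvd.mp h2)
    omega
  · rintro ⟨hdeg, hev⟩
    refine ⟨?_, fun i => ?_⟩
    · rintro rfl
      simp at hdeg
      omega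
    · refine Int.ModEq.trans (Int.modEq_zero_iff_dvd.mpr ⟨1, ?_⟩) ((hmod i).1 (hev i)).symm
      omega

lemma degree_sum_single_erase (i : Fin n) :
    (∑ j ∈ Finset.univ.erase i, Finsupp.single j 1 : Fin n →₀ ℕ).degree = n - 1 := by
  rw [map_sum]; simp

lemma isTrivialExponent_add_iff (hn : 3 ≤ n) (b : Fin n →₀ ℕ) (i : Fin n) :
    IsTrivialExponent (b + ∑ j ∈ Finset.univ.erase i, Finsupp.single j 1) ↔
      IsTrivialExponent (b + Finsupp.single i 1) := by
  have e1 : (b + ∑ j ∈ Finset.univ.erase i, Finsupp.single j 1 : Fin n →₀ ℕ).degree =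
      b.degree + (n - 1) := by rw [map_add, degree_sum_single_erase]
  have e2 : (b + Finsupp.single i 1 : Fin n →₀ ℕ).degree = b.degree + 1 := by
    rw [map_add]; simp
  have h1 : (b + ∑ j ∈ Finset.univ.erase i, Finsupp.single j 1 : Fin n →₀ ℕ) ≠ 0 := by
    intro h; rw [h] at e1; simp at e1; omega
  have h2 : (b + Finsupp.single i 1 : Fin n →₀ ℕ) ≠ 0 := by
    intro h; rw [h] at e2; simp at e2
  simp only [IsTrivialExponent, ne_eq, h1, h2, not_false_eq_true, true_and]
  refine forall_congr' fun k => ?_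
  have c1 : (∑ j ∈ Finset.univ.erase i, Finsupp.single j 1 : Fin n →₀ ℕ) k =
      if k = i then 0 else 1 := by
    rw [Finsupp.finsetSum_apply]
    simp only [Finsupp.single_apply, Finset.sum_ite_eq', Finset.mem_erase, Finset.mem_univ,
      and_true]
    split_ifs <;> simp_all
  have c2 : (Finsupp.single i 1 : Fin n →₀ ℕ) k = if k = i then 1 else 0 := by
    simp [Finsupp.single_apply, eq_comm]
  rw [Int.modEq_iff_dvd, Int.modEq_iff_dvd, e1, e2, Finsupp.add_apply, Finsupp.add_apply, c1, c2]
  push_cast [show 1 ≤ n by omega]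
  -- At `k = i` the two differences differ by exactly the modulus `2(n - 2)`; elsewhere they
  -- coincide.
  split_ifs
  · rw [← dvd_sub_self_right (a := 2 * ((n : ℤ) - 2)) (b := (b k + 1) * _ - _)]
    ring_nf
  · ring_nf

lemma exists_weight_binomialIdeal (hn : 2 ≤ n) :
    ∃ w : (Fin n →₀ ℕ) → F, binomialIdeal F n ≤ annihilatorIdeal (weightFunctional w) ∧
      ∀ a : Fin n →₀ ℕ, a.degree ≤ 2 * n - 4 → w a = evenWeight F n (2 * n - 4) a := by
  classical
  obtain rfl | hn := hn.eq_or_lt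
  -- For `n = 2` the degree is `0` and the functional is evaluation at the origin.
  · refine ⟨evenWeight F 2 (2 * 2 - 4), ?_, fun _ _ => rfl⟩
    rw [binomialIdeal, if_pos rfl, Ideal.span_le]
    rintro _ ⟨i, rfl⟩
    refine mem_annihilatorIdeal_weightFunctional.mpr fun b => ?_
    change weightFunctional _ (monomial (Finsupp.single i 1) 1) = 0
    rw [weightFunctional_monomial, evenWeight, if_neg, mul_zero]
    simp [map_add]
  · refine ⟨fun a => if IsTrivialExponent a then 1 else 0, ?_, fun a ha => ?_⟩
    · rw [binomialIdeal, if_neg hn.ne', Ideal.span_le]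
      rintro _ ⟨i, rfl⟩
      refine mem_annihilatorIdeal_weightFunctional.mpr fun b => ?_
      change weightFunctional _
        (∏ j ∈ Finset.univ.erase i, X j - monomial (Finsupp.single i 1) 1) = 0
      rw [prod_erase_X_eq_monomial, map_sub, weightFunctional_monomial,
        weightFunctional_monomial, isTrivialExponent_add_iff hn b i, sub_self]
    · simp only [evenWeight, isTrivialExponent_iff_of_degree_le hn ha]

lemma topDegreeIdeal_binomialIdeal_le (hn : 2 ≤ n) :
    topDegreeIdeal (binomialIdeal F n) ≤
      annihilatorIdeal (weightFunctional (evenWeight F n (2 * n - 4))) := by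
  obtain ⟨w, h1, h2⟩ := exists_weight_binomialIdeal (F := F) hn
  exact topDegreeIdeal_le_annihilatorIdeal w h1 h2

end binomialIdeal

/-! ### Reduction to normal monomials -/

section reduction

variable {Q : Type*} [CommRing Q] {n : ℕ} {x : Fin n → Q} {u : Q}

/-- If all `x_i` have square `u` and all products of `n - 1` of them vanish, then
`u ^ k ∏_{i ∈ S} x_i` vanishes as soon as `k + |S| ≥ n - 1`. -/
lemma pow_mul_prod_eq_zero (hu : ∀ i, x i ^ 2 = u) (hn : 1 ≤ n)
    (hx : ∀ i, ∏ j ∈ Finset.univ.erase i, x j = 0) (k : ℕ) (S : Finset (Fin n))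
    (h : n - 1 ≤ k + S.card) : u ^ k * ∏ i ∈ S, x i = 0 := by
  have hfull : ∏ i, x i = 0 := by
    rw [← Finset.mul_prod_erase _ _ (Finset.mem_univ ⟨0, hn⟩), hx, mul_zero]
  induction k generalizing S with
  | zero =>
    obtain rfl | ⟨i, hi⟩ : S = Finset.univ ∨ ∃ i, i ∉ S := by
      by_cases hS : S = Finset.univ
      · exact .inl hS
      · right; by_contra! hcon; exact hS (Finset.eq_univ_iff_forall.mpr hcon)
    · rw [hfull, mul_zero]
    · have hS : S = Finset.univ.erase i := by
        refine Finset.eq_of_subset_of_card_le (fun j hj => ?_) ?_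
        · exact Finset.mem_erase.mpr ⟨fun hji => hi (hji ▸ hj), Finset.mem_univ j⟩
        · rw [Finset.card_erase_of_mem (Finset.mem_univ i), Finset.card_univ, Fintype.card_fin]
          omega
      rw [hS, hx, mul_zero]
  | succ k ih =>
    by_cases hS : S = Finset.univ
    · rw [hS, hfull, mul_zero]
    · obtain ⟨i, hi⟩ : ∃ i, i ∉ S := by
        by_contra! hcon; exact hS (Finset.eq_univ_iff_forall.mpr hcon)
      have h1 := ih (insert i S) (by rw [Finset.card_insert_of_notMem hi]; omega)
      rw [Finset.prod_insert hi] at h1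
      -- One factor `u` is traded for `x i * x i`, and one of these enlarges `S`.
      calc u ^ (k + 1) * ∏ i ∈ S, x i = x i * (u ^ k * (x i * ∏ i ∈ S, x i)) := by
            rw [pow_succ, ← hu i]; ring
        _ = 0 := by rw [h1, mul_zero]

lemma prod_pow_eq_pow_mul_prod (hu : ∀ i, x i ^ 2 = u) (a : Fin n → ℕ) :
    ∏ i, x i ^ a i = u ^ (∑ i, a i / 2) * ∏ i with Odd (a i), x i := by
  rw [← Finset.prod_pow_eq_pow_sum, Finset.prod_filter, ← Finset.prod_mul_distrib]
  refine Finset.prod_congr rfl fun i _ => ?_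
  rw [← hu i, ← pow_mul]
  split_ifs with h
  · rw [← pow_succ, Nat.two_mul_div_two_add_one_of_odd h]
  · rw [mul_one, Nat.two_mul_div_two_of_even (Nat.not_odd_iff_even.mp h)]

end reduction

/-- The indices of the monomials forming a basis of the quotient by the top-degree ideal. -/
def normalIndices (n : ℕ) : Finset (ℕ × Finset (Fin n)) :=
  (Finset.range (n - 1) ×ˢ Finset.univ).filter fun p => p.1 + p.2.card ≤ n - 2

lemma mem_normalIndices {n : ℕ} (hn : 2 ≤ n) {p : ℕ × Finset (Fin n)} :
    p ∈ normalIndices n ↔ p.1 + p.2.card ≤ n - 2 := by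
  simp only [normalIndices, Finset.mem_filter, Finset.mem_product, Finset.mem_range,
    Finset.mem_univ, and_true, and_iff_right_iff_imp]
  omega

/-! ### Normal monomials and their dual basis -/

section normalForm

variable {F : Type*} [Field F] {n : ℕ} [NeZero n]

/-- The exponent of the monomial `x_1 ^ (2 k) ∏_{i ∈ S} x_i`. -/
noncomputable def normalExponent (p : ℕ × Finset (Fin n)) : Fin n →₀ ℕ :=
  Finsupp.single 0 (2 * p.1) + ∑ i ∈ p.2, Finsupp.single i 1

lemma degree_normalExponent (p : ℕ × Finset (Fin n)) :
    (normalExponent p).degree = 2 * p.1 + p.2.card := by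
  rw [normalExponent, map_add, map_sum, Finsupp.degree_single]
  simp

lemma even_normalExponent_add_iff (p q : ℕ × Finset (Fin n)) (i : Fin n) :
    Even ((normalExponent p + normalExponent q) i) ↔ (i ∈ p.2 ↔ i ∈ q.2) := by
  have key (p : ℕ × Finset (Fin n)) : Even (normalExponent p i) ↔ i ∉ p.2 := by
    have h : normalExponent p i = 2 * (if i = 0 then p.1 else 0) + if i ∈ p.2 then 1 else 0 := by
      simp only [normalExponent, Finsupp.add_apply, Finsupp.finsetSum_apply, Finsupp.single_apply,
        Finset.sum_ite_eq']
      split_ifs <;> simp_all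
    rw [h]
    split_ifs <;> simp_all [Nat.even_add_one]
  rw [Finsupp.add_apply, Nat.even_add, key, key, not_iff_not]

/-- Evenness of the sum forces equal sets `S`; the degree condition then determines the power of
`u`. -/
lemma evenWeight_normalExponent_add (hn : 2 ≤ n) {p q : ℕ × Finset (Fin n)}
    (hp : p ∈ normalIndices n) :
    evenWeight F n (2 * n - 4)
      (normalExponent (n - 2 - p.1 - p.2.card, p.2) + normalExponent q) =
      if q = p then 1 else 0 := by
  rw [mem_normalIndices hn] at hp
  rw [evenWeight]
  refine if_congr ?_ rfl rfl
  simp only [even_normalExponent_add_iff, map_add, degree_normalExponent]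
  rw [← Finset.ext_iff, Prod.ext_iff]
  constructor
  · rintro ⟨h1, h2⟩
    rw [← h2] at h1
    exact ⟨by omega, h2.symm⟩
  · rintro ⟨h1, h2⟩
    rw [h1, h2]
    exact ⟨by omega, rfl⟩

lemma monomial_normalExponent (p : ℕ × Finset (Fin n)) :
    monomial (normalExponent p) (1 : F) = (X 0 ^ 2) ^ p.1 * ∏ i ∈ p.2, X i := by
  rw [normalExponent, ← mul_one (1 : F), ← monomial_mul, monomial_sum_one, ← pow_mul,
    X_pow_eq_monomial]
  simp only [X]

/-- Modulo an ideal containing `X i ^ 2 - X j ^ 2` and the products of `n - 1` variables, every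
polynomial is a combination of the normal monomials. -/
lemma exists_sub_sum_mem {K : Ideal (MvPolynomial (Fin n) F)} (hn : 2 ≤ n)
    (hsq : ∀ i j, X i ^ 2 - X j ^ 2 ∈ K) (hprod : ∀ i, ∏ j ∈ Finset.univ.erase i, X j ∈ K)
    (f : MvPolynomial (Fin n) F) :
    ∃ c : ℕ × Finset (Fin n) → F,
      f - ∑ p ∈ normalIndices n, monomial (normalExponent p) (c p) ∈ K := by
  induction f using MvPolynomial.induction_on' with
  | monomial a r =>
    classical
    have hu (i : Fin n) : (Ideal.Quotient.mk K (X i)) ^ 2 = Ideal.Quotient.mk K (X 0 ^ 2) := by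
      rw [← map_pow]
      exact Ideal.Quotient.eq.mpr (hsq i 0)
    have hx (i : Fin n) : ∏ j ∈ Finset.univ.erase i, Ideal.Quotient.mk K (X j) = 0 := by
      rw [← map_prod]
      exact Ideal.Quotient.eq_zero_iff_mem.mpr (hprod i)
    let q : ℕ × Finset (Fin n) := (∑ i, a i / 2, Finset.univ.filter fun i => Odd (a i))
    have hq : Ideal.Quotient.mk K (monomial a r) =
        Ideal.Quotient.mk K (monomial (normalExponent q) r) := by
      rw [← mul_one r, ← C_mul_monomial, ← C_mul_monomial, map_mul, map_mul,
        monomial_normalExponent, map_mul, map_pow, map_prod, ← prod_pow_eq_pow_mul_prod hu,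
        monomial_eq, Finsupp.prod_fintype _ _ (by simp)]
      simp
    by_cases hmem : q ∈ normalIndices n
    · refine ⟨fun p => if p = q then r else 0, Ideal.Quotient.eq.mp ?_⟩
      rw [hq, Finset.sum_eq_single q (fun p _ hp => by simp [hp]) (fun h => absurd hmem h)]
      simp
    · refine ⟨0, Ideal.Quotient.eq.mp ?_⟩
      rw [mem_normalIndices hn] at hmem
      rw [hq, ← mul_one r, ← C_mul_monomial, map_mul, monomial_normalExponent, map_mul, map_pow,
        map_prod, pow_mul_prod_eq_zero hu (by omega) hx _ _ (by omega)]
      simp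
  | add f g hf hg =>
    obtain ⟨c, hc⟩ := hf
    obtain ⟨d, hd⟩ := hg
    refine ⟨c + d, ?_⟩
    convert add_mem hc hd using 1
    simp only [Pi.add_apply, map_add, Finset.sum_add_distrib]
    ring

/-- The normal form of an element of the annihilator is again annihilated, and pairing with the dual
monomials reads off its coefficients, which are therefore zero. -/
lemma annihilatorIdeal_evenWeight_le {K : Ideal (MvPolynomial (Fin n) F)} (hn : 2 ≤ n)
    (hsq : ∀ i j, X i ^ 2 - X j ^ 2 ∈ K) (hprod : ∀ i, ∏ j ∈ Finset.univ.erase i, X j ∈ K)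
    (hK : K ≤ annihilatorIdeal (weightFunctional (evenWeight F n (2 * n - 4)))) :
    annihilatorIdeal (weightFunctional (evenWeight F n (2 * n - 4))) ≤ K := by
  intro f hf
  obtain ⟨c, hc⟩ := exists_sub_sum_mem hn hsq hprod f
  have hsum := sub_mem hf (hK hc)
  rw [sub_sub_cancel, mem_annihilatorIdeal_weightFunctional] at hsum
  have hc0 : ∀ p ∈ normalIndices n, c p = 0 := by
    intro p hp
    have h := hsum (normalExponent (n - 2 - p.1 - p.2.card, p.2))
    simp only [map_sum, weightFunctional_monomial, evenWeight_normalExponent_add hn hp] at h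
    simpa [hp] using h
  rw [Finset.sum_eq_zero fun p hp => by rw [hc0 p hp, map_zero], sub_zero] at hc
  exact hc

lemma finite_quotient_of_mem {K : Ideal (MvPolynomial (Fin n) F)} (hn : 2 ≤ n)
    (hsq : ∀ i j, X i ^ 2 - X j ^ 2 ∈ K) (hprod : ∀ i, ∏ j ∈ Finset.univ.erase i, X j ∈ K) :
    Module.Finite F (MvPolynomial (Fin n) F ⧸ K) := by
  let φ : (normalIndices n → F) →ₗ[F] MvPolynomial (Fin n) F ⧸ K :=
    (Ideal.Quotient.mkₐ F K).toLinearMap ∘ₗ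
      ∑ p : normalIndices n, monomial (normalExponent p.1) ∘ₗ LinearMap.proj p
  refine Module.Finite.of_surjective φ fun y => ?_
  obtain ⟨f, rfl⟩ := Ideal.Quotient.mk_surjective y
  obtain ⟨c, hc⟩ := exists_sub_sum_mem hn hsq hprod f
  refine ⟨fun p => c p, ?_⟩
  rw [Ideal.Quotient.eq.mpr hc, ← Finset.sum_coe_sort]
  simp [φ]

end normalForm

section topDegree

variable {F : Type*} [Field F] {n : ℕ}

theorem topDegreeIdeal_binomialIdeal_eq (hn : 2 ≤ n) :
    topDegreeIdeal (binomialIdeal F n) =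
      annihilatorIdeal (weightFunctional (evenWeight F n (2 * n - 4))) := by
  have : NeZero n := ⟨by omega⟩
  exact le_antisymm (topDegreeIdeal_binomialIdeal_le hn)
    (annihilatorIdeal_evenWeight_le hn X_sq_sub_X_sq_mem_topDegreeIdeal
      (prod_erase_mem_topDegreeIdeal hn) (topDegreeIdeal_binomialIdeal_le hn))

lemma finite_quotient_topDegreeIdeal (hn : 2 ≤ n) :
    Module.Finite F (MvPolynomial (Fin n) F ⧸ topDegreeIdeal (binomialIdeal F n)) := by
  have : NeZero n := ⟨by omega⟩
  exact finite_quotient_of_mem hn X_sq_sub_X_sq_mem_topDegreeIdeal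
    (prod_erase_mem_topDegreeIdeal hn)

end topDegree

/-! ### Frobenius algebras are Gorenstein -/

section Frobenius

variable {F A : Type*} [Field F] [CommRing A] [Algebra F A]

/-- A finite-dimensional algebra with a functional whose kernel contains no nonzero ideal is
self-injective. -/
lemma baer_of_annihilatorIdeal_eq_bot [Module.Finite F A] (μ : A →ₗ[F] F)
    (hμ : annihilatorIdeal μ = ⊥) : Module.Baer A A := by
  -- Nondegeneracy makes `c ↦ μ (c * ·)` injective into the dual, hence surjective by dimension. So
  -- an extension of `μ ∘ φ` to `A` has the form `μ (c * ·)`, and `φ` is multiplication by `c`.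
  have hsurj : Function.Surjective ((LinearMap.mul F A).compr₂ μ) := by
    refine (LinearMap.injective_iff_surjective_of_finrank_eq_finrank
      (Subspace.dual_finrank_eq (K := F) (V := A)).symm).mp ?_
    refine (injective_iff_map_eq_zero _).mpr fun c hc => ?_
    have hmem : c ∈ annihilatorIdeal μ := fun g => by
      rw [mul_comm]
      exact LinearMap.congr_fun hc g
    rwa [hμ, Ideal.mem_bot] at hmem
  intro I φ
  obtain ⟨ψ, hψ⟩ := LinearMap.exists_extend (p := I.restrictScalars F)
    (μ ∘ₗ (φ.restrictScalars F))
  obtain ⟨c, hc⟩ := hsurj ψ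
  refine ⟨LinearMap.mulLeft A c, fun x hx => ?_⟩
  have hmem : c * x - φ ⟨x, hx⟩ ∈ annihilatorIdeal μ := by
    intro r
    have h1 := LinearMap.congr_fun hψ ⟨r * x, I.mul_mem_left r hx⟩
    have h2 : φ ⟨r * x, I.mul_mem_left r hx⟩ = r * φ ⟨x, hx⟩ := by
      rw [← smul_eq_mul r (φ _), ← map_smul]
      rfl
    have h3 : μ (c * (r * x)) = μ (r * φ ⟨x, hx⟩) := by
      rw [← h2]
      exact (LinearMap.congr_fun hc (r * x)).trans h1
    rw [mul_sub, map_sub, sub_eq_zero, ← h3]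
    congr 1
    ring
  rw [hμ, Ideal.mem_bot, sub_eq_zero] at hmem
  exact hmem

lemma injectiveDimension_ne_top_of_baer {A : Type*} [CommRing A] (h : Module.Baer A A) :
    CategoryTheory.injectiveDimension (ModuleCat.of A A) ≠ ⊤ := by
  have hinj := (Module.injective_iff_injective_object A A).mp h.injective
  rw [CategoryTheory.injectiveDimension_ne_top_iff]
  exact ⟨0, (CategoryTheory.injective_iff_hasInjectiveDimensionLT_one).mp hinj⟩

/-- A finite-dimensional algebra in which every element is a unit or nilpotent is Gorenstein as
soon as it has a functional whose kernel contains no nonzero ideal. -/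
lemma isGorensteinRing_of_annihilatorIdeal_eq_bot [Module.Finite F A] (μ : A →ₗ[F] F)
    (hμ : annihilatorIdeal μ = ⊥) (hA : ∀ a : A, IsUnit a ∨ IsNilpotent a) :
    IsGorensteinRing A := by
  have hnoeth : IsNoetherianRing A := IsNoetherianRing.of_finite F A
  refine ⟨hnoeth, fun p _ => ⟨inferInstance, ?_, ?_⟩⟩
  · exact IsLocalization.isNoetherianRing p.primeCompl _ hnoeth
  -- Elements outside `p` are not nilpotent, hence units, so localizing changes nothing.
  · let e : A ≃ₐ[A] Localization.AtPrime p := IsLocalization.atUnits A p.primeCompl fun a ha => by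
      refine (hA a).resolve_right fun hnil => ha ?_
      obtain ⟨k, hk⟩ := hnil
      exact Ideal.IsPrime.mem_of_pow_mem ‹_› k (hk ▸ p.zero_mem)
    let e' : A ≃ₐ[F] Localization.AtPrime p := e.restrictScalars F
    have : Module.Finite F (Localization.AtPrime p) := Module.Finite.equiv e'.toLinearEquiv
    refine injectiveDimension_ne_top_of_baer
      (baer_of_annihilatorIdeal_eq_bot (μ ∘ₗ e'.symm.toLinearMap) ?_)
    refine (Submodule.eq_bot_iff _).mpr fun x hx => ?_
    have hmem : e'.symm x ∈ annihilatorIdeal μ := fun g => by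
      simpa using hx (e' g)
    rw [hμ, Ideal.mem_bot] at hmem
    simpa using hmem

end Frobenius

/-! ### Height and locality when the variables are nilpotent -/

section height

variable {F : Type*} [Field F] {n : ℕ}

lemma sub_C_constantCoeff_mem {σ : Type*} {J : Ideal (MvPolynomial σ F)} (hJ : ∀ i, X i ∈ J)
    (f : MvPolynomial σ F) : f - C (constantCoeff f) ∈ J := by
  induction f using MvPolynomial.induction_on with
  | C a => simp
  | add p q hp hq =>
    rw [map_add, map_add, add_sub_add_comm]
    exact add_mem hp hq
  | mul_X p i _ =>
    simpa using J.mul_mem_left p (hJ i)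

lemma ker_constantCoeff_le {σ : Type*} {J : Ideal (MvPolynomial σ F)} (hJ : ∀ i, X i ∈ J) :
    RingHom.ker (constantCoeff : MvPolynomial σ F →+* F) ≤ J := by
  intro f hf
  have h := sub_C_constantCoeff_mem hJ f
  rwa [RingHom.mem_ker.mp hf, map_zero, sub_zero] at h

instance isMaximal_ker_constantCoeff {σ : Type*} :
    (RingHom.ker (constantCoeff : MvPolynomial σ F →+* F)).IsMaximal :=
  RingHom.ker_isMaximal_of_surjective _ fun c => ⟨C c, constantCoeff_C _ c⟩

/-- The substitution killing the first `k` variables. -/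
noncomputable def killVariables (F : Type*) [Field F] (n k : ℕ) :
    MvPolynomial (Fin n) F →ₐ[F] MvPolynomial (Fin n) F :=
  aeval fun i => if i.val < k then 0 else X i

lemma killVariables_X (k : ℕ) (i : Fin n) :
    killVariables F n k (X i) = if i.val < k then 0 else X i := aeval_X _ _

lemma killVariables_succ_killVariables (k : ℕ) (f : MvPolynomial (Fin n) F) :
    killVariables F n (k + 1) (killVariables F n k f) = killVariables F n (k + 1) f := by
  rw [← AlgHom.comp_apply]
  congr 1
  refine algHom_ext fun i => ?_
  rw [AlgHom.comp_apply, killVariables_X, killVariables_X]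
  split_ifs with h1 h2 h2
  · exact map_zero _
  · omega
  · rw [killVariables_X, if_pos h2]
  · rw [killVariables_X, if_neg h2]

lemma constantCoeff_killVariables (k : ℕ) (f : MvPolynomial (Fin n) F) :
    constantCoeff (killVariables F n k f) = constantCoeff f := by
  induction f using MvPolynomial.induction_on with
  | C a => rw [← algebraMap_eq, AlgHom.commutes]
  | add p q hp hq => rw [map_add, map_add, map_add, hp, hq]
  | mul_X p i _ =>
    rw [map_mul, map_mul, map_mul, killVariables_X, constantCoeff_X]
    split_ifs <;> simp

/-- The kernels form a strictly increasing chain of primes, since the targets are domains. -/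
lemma le_height_ker_killVariables {k : ℕ} (hk : k ≤ n) :
    (k : ℕ∞) ≤ (RingHom.ker (killVariables F n k)).height := by
  induction k with
  | zero => simp
  | succ k ih =>
    have h1 : RingHom.ker (killVariables F n k) < RingHom.ker (killVariables F n (k + 1)) := by
      refine lt_of_le_not_ge (fun f hf => ?_) fun hle => ?_
      · rw [RingHom.mem_ker] at hf ⊢
        rw [← killVariables_succ_killVariables, hf, map_zero]
      · have hX : (X ⟨k, hk⟩ : MvPolynomial (Fin n) F) ∈ RingHom.ker (killVariables F n (k + 1)) := by
          rw [RingHom.mem_ker, killVariables_X, if_pos (Nat.lt_succ_self k)]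
        have h := hle hX
        rw [RingHom.mem_ker, killVariables_X, if_neg (lt_irrefl k)] at h
        exact X_ne_zero _ h
    have := RingHom.ker_isPrime (killVariables F n k)
    have := RingHom.ker_isPrime (killVariables F n (k + 1))
    have h2 := Ideal.height_add_one_le_of_lt_of_isPrime h1
    push_cast
    exact (add_le_add_left (ih (by omega)) 1).trans h2

lemma height_ker_constantCoeff :
    (RingHom.ker (constantCoeff : MvPolynomial (Fin n) F →+* F)).height = n := by
  apply le_antisymm
  · have hspan : RingHom.ker (constantCoeff : MvPolynomial (Fin n) F →+* F) =
        Ideal.span (Set.range X) := by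
      refine le_antisymm (ker_constantCoeff_le fun i => Ideal.subset_span ⟨i, rfl⟩) ?_
      rw [Ideal.span_le]
      rintro _ ⟨i, rfl⟩
      exact constantCoeff_X _ i
    have htop := (isMaximal_ker_constantCoeff (F := F) (σ := Fin n)).ne_top
    refine (Ideal.height_le_spanFinrank _ htop).trans ?_
    rw [hspan]
    refine Nat.cast_le.mpr
      ((Submodule.spanFinrank_span_le_ncard_of_finite (Set.finite_range _)).trans ?_)
    rw [← Set.image_univ]
    refine (Set.ncard_image_le Set.finite_univ).trans ?_
    simp [Set.ncard_univ]
  · refine (le_height_ker_killVariables (F := F) le_rfl).trans (Ideal.height_mono fun f hf => ?_)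
    rw [RingHom.mem_ker] at hf ⊢
    rw [← constantCoeff_killVariables n, hf, map_zero]

lemma height_eq_of_X_mem_radical {K : Ideal (MvPolynomial (Fin n) F)} (hK : K ≠ ⊤)
    (hX : ∀ i, X i ∈ K.radical) : K.height = n := by
  obtain ⟨M, hM, hKM⟩ := Ideal.exists_le_maximal K hK
  have hle := ker_constantCoeff_le hX
  have hrad : K.radical ≤ M := hM.isPrime.radical_le_iff.mpr hKM
  have hMeq := isMaximal_ker_constantCoeff.eq_of_le hM.ne_top (hle.trans hrad)
  have hradeq := le_antisymm (hrad.trans hMeq.ge) hle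
  rw [Ideal.height_eq_inf_minimalPrimes, ← Ideal.radical_minimalPrimes,
    ← Ideal.height_eq_inf_minimalPrimes, hradeq, height_ker_constantCoeff]

lemma isUnit_or_isNilpotent_of_X_mem_radical {K : Ideal (MvPolynomial (Fin n) F)}
    (hX : ∀ i, X i ∈ K.radical) (a : MvPolynomial (Fin n) F ⧸ K) : IsUnit a ∨ IsNilpotent a := by
  obtain ⟨f, rfl⟩ := Ideal.Quotient.mk_surjective a
  have hnil : IsNilpotent (Ideal.Quotient.mk K (f - C (constantCoeff f))) := by
    obtain ⟨k, hk⟩ := sub_C_constantCoeff_mem hX f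
    exact ⟨k, by rw [← map_pow]; exact Ideal.Quotient.eq_zero_iff_mem.mpr hk⟩
  by_cases hc : constantCoeff f = 0
  · right
    rwa [hc, map_zero, sub_zero] at hnil
  · left
    have hu : IsUnit (Ideal.Quotient.mk K (C (constantCoeff f))) :=
      ((isUnit_iff_ne_zero.mpr hc).map C).map _
    have h := hnil.isUnit_add_left_of_commute hu (Commute.all _ _)
    rwa [← map_add, add_sub_cancel] at h

end height

/-! ### Duality between graded pieces -/

section evenWeight

variable {F : Type*} [Field F] {n D : ℕ}

lemma mem_annihilatorIdeal_evenWeight_of_isHomogeneous {f : MvPolynomial (Fin n) F} {k : ℕ}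
    (hf : f.IsHomogeneous k)
    (h : ∀ b : Fin n →₀ ℕ, b.degree + k = D →
      weightFunctional (evenWeight F n D) (monomial b 1 * f) = 0) :
    f ∈ annihilatorIdeal (weightFunctional (evenWeight F n D)) := by
  rw [mem_annihilatorIdeal_weightFunctional]
  intro b
  by_cases hb : b.degree + k = D
  · simpa [weightFunctional_monomial_mul] using h b hb
  · refine weightFunctional_eq_zero fun a ha => ?_
    rw [evenWeight, if_neg]
    rintro ⟨h', -⟩
    have hak : k = a.degree := hf.degree_eq_sum_deg_support ha
    rw [map_add, ← hak] at h'
    exact hb h'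

lemma annihilatorIdeal_evenWeight_ne_top [NeZero n] (hD : Even D) :
    annihilatorIdeal (weightFunctional (evenWeight F n D)) ≠ ⊤ := by
  rw [Ideal.ne_top_iff_one]
  intro h
  have h1 := h (monomial (Finsupp.single 0 D) 1)
  rw [mul_one, weightFunctional_monomial, one_mul, evenWeight, if_pos] at h1
  · exact one_ne_zero h1
  · refine ⟨Finsupp.degree_single _ _, fun i => ?_⟩
    rw [Finsupp.single_apply]
    split_ifs
    exacts [hD, Even.zero]

lemma X_mem_radical_annihilatorIdeal_evenWeight (i : Fin n) :
    X i ∈ (annihilatorIdeal (weightFunctional (evenWeight F n D))).radical :=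
  ⟨D + 1, mem_annihilatorIdeal_evenWeight_of_isHomogeneous (isHomogeneous_X_pow i (D + 1))
    fun b hb => by omega⟩

/-- `μ` vanishes on its annihilator (test with `g = 1`), so composing with any linear section gives
the induced functional. -/
lemma exists_quotient_functional {A : Type*} [CommRing A] [Algebra F A] (μ : A →ₗ[F] F) :
    ∃ ν : A ⧸ annihilatorIdeal μ →ₗ[F] F, (∀ a, ν (Ideal.Quotient.mk _ a) = μ a) ∧
      annihilatorIdeal ν = ⊥ := by
  obtain ⟨s, hs⟩ := LinearMap.exists_rightInverse_of_surjective
    (Ideal.Quotient.mkₐ F (annihilatorIdeal μ)).toLinearMap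
    (LinearMap.range_eq_top.mpr Ideal.Quotient.mk_surjective)
  have key (a : A) : (μ ∘ₗ s) (Ideal.Quotient.mk _ a) = μ a := by
    have h1 : Ideal.Quotient.mk (annihilatorIdeal μ) (s (Ideal.Quotient.mk _ a)) =
        Ideal.Quotient.mk _ a := LinearMap.congr_fun hs _
    have h2 := Ideal.Quotient.eq.mp h1 1
    rwa [one_mul, map_sub, sub_eq_zero] at h2
  refine ⟨μ ∘ₗ s, key, (Submodule.eq_bot_iff _).mpr fun x hx => ?_⟩
  obtain ⟨a, rfl⟩ := Ideal.Quotient.mk_surjective x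
  refine Ideal.Quotient.eq_zero_iff_mem.mpr fun g => ?_
  rw [← key, map_mul]
  exact hx _

lemma quotientPiece_eq_bot {k : ℕ} (hk : D < k) :
    quotientPiece (annihilatorIdeal (weightFunctional (evenWeight F n D))) k = ⊥ := by
  refine (Submodule.eq_bot_iff _).mpr ?_
  rintro _ ⟨f, hf, rfl⟩
  exact Ideal.Quotient.eq_zero_iff_mem.mpr
    (mem_annihilatorIdeal_evenWeight_of_isHomogeneous hf fun b hb => by omega)

/-- Only monomials of complementary degree test membership of a form in the annihilator, so the
pairing embeds one piece in the dual of the other. -/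
lemma finrank_quotientPiece_le {k l : ℕ} (hkl : k + l = D)
    [Module.Finite F (MvPolynomial (Fin n) F ⧸
      annihilatorIdeal (weightFunctional (evenWeight F n D)))] :
    Module.finrank F
        (quotientPiece (annihilatorIdeal (weightFunctional (evenWeight F n D))) k) ≤
      Module.finrank F
        (quotientPiece (annihilatorIdeal (weightFunctional (evenWeight F n D))) l) := by
  obtain ⟨ν, hν, -⟩ := exists_quotient_functional (weightFunctional (evenWeight F n D))
  let φ := ((LinearMap.mul F (MvPolynomial (Fin n) F ⧸ _)).compr₂ ν).domRestrict₁₂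
    (quotientPiece _ k) (quotientPiece _ l)
  rw [← Subspace.dual_finrank_eq (K := F) (V := quotientPiece _ l)]
  refine LinearMap.finrank_le_finrank_of_injective (f := φ) ?_
  refine (injective_iff_map_eq_zero φ).mpr ?_
  rintro ⟨_, f, hf, rfl⟩ hx
  refine Subtype.ext (Ideal.Quotient.eq_zero_iff_mem.mpr
    (mem_annihilatorIdeal_evenWeight_of_isHomogeneous hf fun b hb => ?_))
  have hb' : monomial b (1 : F) ∈ homogeneousSubmodule (Fin n) F l :=
    isHomogeneous_monomial _ (by omega)
  have h := LinearMap.congr_fun hx ⟨_, monomial b 1, hb', rfl⟩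
  rw [← hν, mul_comm, map_mul]
  exact h

end evenWeight

theorem mainTheorem3 (F : Type*) [Field F] [IsAlgClosed F] [CharZero F] (n : ℕ) (hn : 2 ≤ n)
    (K : Ideal (MvPolynomial (Fin n) F)) (hK : K = topDegreeIdeal (binomialIdeal F n)) :
    K.IsHomogeneous (MvPolynomial.homogeneousSubmodule (Fin n) F) ∧
    IsArtinianRing (MvPolynomial (Fin n) F ⧸ K) ∧
    K.height = n ∧
    IsGorensteinRing (MvPolynomial (Fin n) F ⧸ K) ∧
    (∀ k : ℕ, 2 * n - 4 < k → PowerSeries.coeff k (hilbertSeries K) = 0) ∧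
    (∀ k : ℕ, k ≤ 2 * n - 4 → PowerSeries.coeff k (hilbertSeries K) =
      PowerSeries.coeff (2 * n - 4 - k) (hilbertSeries K)) := by
  have : NeZero n := ⟨by omega⟩
  have hhom := isHomogeneous_topDegreeIdeal (binomialIdeal F n)
  have hfin := finite_quotient_topDegreeIdeal (F := F) hn
  rw [← hK] at hhom hfin
  rw [topDegreeIdeal_binomialIdeal_eq hn] at hK
  subst hK
  have hX (i : Fin n) := X_mem_radical_annihilatorIdeal_evenWeight (F := F) (D := 2 * n - 4) i
  have hD : Even (2 * n - 4) := ⟨n - 2, by omega⟩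
  refine ⟨hhom, IsArtinianRing.of_finite F _,
    height_eq_of_X_mem_radical (annihilatorIdeal_evenWeight_ne_top hD) hX, ?_,
    fun k hk => ?_, fun k hk => ?_⟩
  · obtain ⟨ν, -, hν⟩ := exists_quotient_functional (weightFunctional (evenWeight F n (2 * n - 4)))
    exact isGorensteinRing_of_annihilatorIdeal_eq_bot ν hν
      (isUnit_or_isNilpotent_of_X_mem_radical hX)
  · rw [hilbertSeries, PowerSeries.coeff_mk, quotientPiece_eq_bot hk, finrank_bot]
  · rw [hilbertSeries, PowerSeries.coeff_mk, PowerSeries.coeff_mk]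
    exact le_antisymm (finrank_quotientPiece_le (by omega)) (finrank_quotientPiece_le (by omega))
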